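/- Let $X$ be a set with $|X|\ge 2$ (of arbitrary cardinality) and let $r:X\times X\to X\times X$, $r(x,y)=({}^{x}y,x^{y})$, be a solution, that is, $r$ is involutive ($r^2=\mathrm{id}$), non-degenerate (all maps $\mathcal L_x:y\mapsto{}^{x}y$ and $\mathcal R_y:x\mapsto x^{y}$ are bijections of $X$) and satisfies the braid relation $r^{12}r^{23}r^{12}=r^{23}r^{12}r^{23}$ on $X^3$. Assume that $(X,r)$ is square-free: $r(x,x)=(x,x)$ for all $x\in X$. Let $G=G(X,r)$ be the group generated by $X$ with the relations $xy=({}^{x}y)(x^{y})$, $x,y\in X$; let $\mathcal L:G\to\mathrm{Sym}(X)$ be the homomorphism extending $x\mapsto\mathcal L_x$, through which $G$ acts on $X$, and let $\mathcal G=\mathcal G(X,r)=\mathcal L(G)$ be the permutation group. The group $G$ carries a unique braiding operator $r_G(a,b)=({}^{a}b,a^{b})$ that extends $r$ (that is, ${}^{ab}u={}^{a}({}^{b}u)$, $a^{uv}=(a^{u})^{v}$, and $uv=({}^{u}v)(u^{v})$ in $G$), and $r_{\mathcal G}(\mathcal L(a),\mathcal L(b))=(\mathcal L({}^{a}b),\mathcal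 L(a^{b}))$ is a well-defined map which makes $\mathcal G$ a symmetric group (a braided group with involutive braiding operator). Assume that $(\mathcal G,r_{\mathcal G})$ satisfies condition lri: $({}^{u}v)^{u}=v={}^{u}(v^{u})$ for all $u,v\in\mathcal G$. Let $X_i$, $i\in I$, be the $G$-orbits in $X$. Then: 1. At least one of the following holds: (a) $(X,r)$ is retractable, that is, $\mathcal L_x=\mathcal L_y$ for some $x\ne y$ in $X$; (b) for every $i\in I$ the induced solution on $X_i$ is a trivial solution or a one-element solution, that is, $r(x,y)=(y,x)$ for all $x,y\in X_i$, and $X$ is the strong twisted union of the orbits $X_i$, $i\in I$. 2. If $X$ is finite, then $(X,r)$ is a multipermutation solution. Here $X$ is the strong twisted union of a family of nonempty subsets $X_i$ if it is their disjoint union, each $X_i$ is $r$-invariant, and for all $i\ne j$ the set $X_i\cup X_j$ is a strong twisted union of $Y=X_i$ and $Z=X_j$: $r$ restricts to bijections $Y\times Z\to Z\times Y$ and $Z\times Y\to Y\times Z$; the assignment $\alpha\mapsto{}^{\alpha}\bullet$ ($\alpha\in Z$) extends to a left action of $G(Z,r|_{Z\times Z})$ on $Y$, and $x\mapsto\bullet^{x}$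 ($x\in Y$) extends to a right action of $G(Y,r|_{Y\times Y})$ on $Z$; and ${}^{\alpha^{y}}x={}^{\alpha}x$, $\alpha^{({}^{\beta}x)}=\alpha^{x}$ for all $x,y\in Y$, $\alpha,\beta\in Z$. The retraction $\mathrm{Ret}(X,r)$ is the solution $r_{[X]}([x],[y])=([{}^{x}y],[x^{y}])$ on the set $[X]$ of classes of the equivalence relation $x\sim y\iff\mathcal L_x=\mathcal L_y$; put $\mathrm{Ret}^0(X,r)=(X,r)$ and $\mathrm{Ret}^{m}(X,r)=\mathrm{Ret}(\mathrm{Ret}^{m-1}(X,r))$. The solution $(X,r)$ is a multipermutation solution if $\mathrm{Ret}^m(X,r)$ is the solution on a one-element set for some integer $m\ge0$. -/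

import Mathlib

universe u

namespace YBE

/-! ### Quadratic sets

A map `r : X × X → X × X` is written `r (x, y) = (ˣy, xʸ)`. -/

/-- The left action `ˣy` of a quadratic set. -/
def lact {X : Type u} (r : X × X → X × X) (x y : X) : X := (r (x, y)).1

/-- The right action `xʸ` of a quadratic set. -/
def ract {X : Type u} (r : X × X → X × X) (x y : X) : X := (r (x, y)).2

/-- `(X, r)` is square-free. -/
def IsSquareFree {X : Type u} (r : X × X → X × X) : Prop := ∀ x, r (x, x) = (x, x)

/-- Condition **lri**: `(ˣy)ˣ = y = ˣ(yˣ)` for all `x`, `y`. -/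
def LRI {X : Type u} (r : X × X → X × X) : Prop :=
  ∀ x y, ract r (lact r x y) x = y ∧ lact r x (ract r y x) = y

/-- `r¹² = r × id`. -/
def r12 {X : Type u} (r : X × X → X × X) : X × X × X → X × X × X :=
  fun p => ((r (p.1, p.2.1)).1, (r (p.1, p.2.1)).2, p.2.2)

/-- `r²³ = id × r`. -/
def r23 {X : Type u} (r : X × X → X × X) : X × X × X → X × X × X :=
  fun p => (p.1, r p.2)

/-- A solution on `X`: a non-degenerate involutive set-theoretic solution `r` of the Yang-Baxter
equation. -/
structure Solution (X : Type u) where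
  r : X × X → X × X
  involutive : r ∘ r = id
  left_bijective : ∀ x, Function.Bijective (lact r x)
  right_bijective : ∀ y, Function.Bijective (fun x => ract r x y)
  braid : r12 r ∘ r23 r ∘ r12 r = r23 r ∘ r12 r ∘ r23 r

namespace Solution

/-- The permutation `𝓛_x : y ↦ ˣy`. -/
noncomputable def leftPerm {X : Type u} (S : Solution X) (x : X) : Equiv.Perm X :=
  Equiv.ofBijective (lact S.r x) (S.left_bijective x)

theorem leftPerm_apply {X : Type u} (S : Solution X) (x y : X) :
    S.leftPerm x y = lact S.r x y := rfl

theorem inv_left {X : Type u} (S : Solution X) (x y : X) :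
    lact S.r (lact S.r x y) (ract S.r x y) = x :=
  congrArg Prod.fst (congrFun S.involutive (x, y))

theorem inv_right {X : Type u} (S : Solution X) (x y : X) :
    ract S.r (lact S.r x y) (ract S.r x y) = y :=
  congrArg Prod.snd (congrFun S.involutive (x, y))

theorem leftPerm_mul {X : Type u} (S : Solution X) (x y : X) :
    S.leftPerm x * S.leftPerm y = S.leftPerm (lact S.r x y) * S.leftPerm (ract S.r x y) := by
  ext z
  exact (congrArg Prod.fst (congrFun S.braid (x, y, z))).symm

theorem lact_lact {X : Type u} (S : Solution X) (x y z : X) :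
    lact S.r x (lact S.r y z) = lact S.r (lact S.r x y) (lact S.r (ract S.r x y) z) :=
  (congrArg Prod.fst (congrFun S.braid (x, y, z))).symm

/-- The diagonal map `x ↦ 𝓛_x⁻¹ x`. -/
noncomputable def diag {X : Type u} (S : Solution X) (x : X) : X := (S.leftPerm x)⁻¹ x

theorem lact_diag {X : Type u} (S : Solution X) (x : X) : lact S.r x (S.diag x) = x :=
  (S.leftPerm x).apply_symm_apply x

theorem ract_diag {X : Type u} (S : Solution X) (x : X) :
    ract S.r x (S.diag x) = S.diag x := by
  have h := S.inv_left x (S.diag x)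
  rw [lact_diag] at h
  exact (S.left_bijective x).1 (h.trans (S.lact_diag x).symm)

theorem diag_bijective {X : Type u} (S : Solution X) : Function.Bijective S.diag := by
  constructor
  · intro x y h
    have hx := S.ract_diag x
    have hy := S.ract_diag y
    rw [← h] at hy
    exact (S.right_bijective (S.diag x)).1 (hx.trans hy.symm)
  · intro z
    obtain ⟨x, hx⟩ := (S.right_bijective z).2 z
    have hx : ract S.r x z = z := hx
    refine ⟨x, ?_⟩
    have h := S.inv_right x z
    rw [hx] at h
    have h2 : lact S.r x z = x := (S.right_bijective z).1 (h.trans hx.symm)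
    exact (S.left_bijective x).1 ((S.lact_diag x).trans h2.symm)

theorem diag_ract {X : Type u} (S : Solution X) (a x : X) :
    S.diag (ract S.r a x) = (S.leftPerm x)⁻¹ (S.diag a) := by
  apply (S.left_bijective (ract S.r a x)).1
  apply (S.left_bijective (lact S.r a x)).1
  have h : lact S.r x ((S.leftPerm x)⁻¹ (S.diag a)) = S.diag a :=
    (S.leftPerm x).apply_symm_apply (S.diag a)
  rw [lact_diag, inv_left, ← lact_lact, h, lact_diag]

/-! ### Retraction -/

/-- `x ∼ y` if and only if `𝓛_x = 𝓛_y`. -/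
def retSetoid {X : Type u} (S : Solution X) : Setoid X where
  r x y := lact S.r x = lact S.r y
  iseqv := ⟨fun _ => rfl, fun h => h.symm, fun h k => h.trans k⟩

/-- `(X, r)` is retractable: two distinct elements act in the same way. -/
def IsRetractable {X : Type u} (S : Solution X) : Prop :=
  ∃ x y : X, x ≠ y ∧ lact S.r x = lact S.r y

theorem ract_congr {X : Type u} (S : Solution X) {x y : X} (h : lact S.r x = lact S.r y)
    (a : X) : ract S.r a x = ract S.r a y := by
  apply S.diag_bijective.1
  have : S.leftPerm x = S.leftPerm y := Equiv.ext (congrFun h)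
  rw [diag_ract, diag_ract, this]

theorem lact_eq_iff {X : Type u} (S : Solution X) (x y : X) :
    lact S.r x = lact S.r y ↔ S.leftPerm x = S.leftPerm y :=
  ⟨fun h => Equiv.ext (congrFun h), fun h => funext fun z => congrArg (fun e => e z) h⟩

theorem rel_lact {X : Type u} (S : Solution X) {a b x y : X} (hab : lact S.r a = lact S.r b)
    (hxy : lact S.r x = lact S.r y) :
    lact S.r (lact S.r a x) = lact S.r (lact S.r b y) := by
  have h1 := S.leftPerm_mul a x
  have h2 := S.leftPerm_mul a y
  rw [S.ract_congr hxy, (S.lact_eq_iff x y).1 hxy, h2] at h1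
  rw [← hab, S.lact_eq_iff]
  exact (mul_right_cancel h1).symm

theorem rel_ract {X : Type u} (S : Solution X) {a b x y : X} (hab : lact S.r a = lact S.r b)
    (hxy : lact S.r x = lact S.r y) :
    lact S.r (ract S.r a x) = lact S.r (ract S.r b y) := by
  have h1 := S.leftPerm_mul a x
  have h2 := S.leftPerm_mul b x
  rw [(S.lact_eq_iff a b).1 hab, hab, h2] at h1
  rw [← S.ract_congr hxy, S.lact_eq_iff]
  exact (mul_left_cancel h1).symm

/-- The induced map `r_[X] ([x], [y]) = ([ˣy], [xʸ])` on the set `[X]` of classes. -/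
def retMap {X : Type u} (S : Solution X) :
    Quotient S.retSetoid × Quotient S.retSetoid → Quotient S.retSetoid × Quotient S.retSetoid :=
  fun p => Quotient.liftOn₂ p.1 p.2
    (fun x y => ((⟦lact S.r x y⟧ : Quotient S.retSetoid), (⟦ract S.r x y⟧ : Quotient S.retSetoid)))
    (fun _ _ _ _ h k => Prod.ext (Quotient.sound (S.rel_lact h k))
      (Quotient.sound (S.rel_ract h k)))

/-- The retraction `Ret(X, r) = ([X], r_[X])`. -/
def ret {X : Type u} (S : Solution X) : Solution (Quotient S.retSetoid) where
  r := S.retMap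
  involutive := by
    funext ⟨p, q⟩
    induction p using Quotient.inductionOn with | h x => ?_
    induction q using Quotient.inductionOn with | h y => ?_
    exact Prod.ext (congrArg (fun z => (⟦z⟧ : Quotient S.retSetoid)) (S.inv_left x y))
      (congrArg (fun z => (⟦z⟧ : Quotient S.retSetoid)) (S.inv_right x y))
  left_bijective := by
    intro p
    induction p using Quotient.inductionOn with | h a => ?_
    constructor
    · intro p q h
      induction p using Quotient.inductionOn with | h x => ?_
      induction q using Quotient.inductionOn with | h y => ?_
      have h : lact S.r (lact S.r a x) = lact S.r (lact S.r a y) := Quotient.exact h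
      have hx := S.inv_left a x
      have hy := S.inv_left a y
      rw [h] at hx
      have e := (S.left_bijective _).1 (hx.trans hy.symm)
      have h1 := S.leftPerm_mul a x
      rw [(S.lact_eq_iff _ _).1 h, e, ← S.leftPerm_mul a y] at h1
      exact Quotient.sound ((S.lact_eq_iff _ _).2 (mul_left_cancel h1))
    · intro q
      induction q using Quotient.inductionOn with | h y => ?_
      obtain ⟨x, hx⟩ := (S.left_bijective a).2 y
      exact ⟨⟦x⟧, congrArg _ hx⟩
  right_bijective := by
    intro p
    induction p using Quotient.inductionOn with | h x => ?_
    constructor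
    · intro p q h
      induction p using Quotient.inductionOn with | h a => ?_
      induction q using Quotient.inductionOn with | h b => ?_
      have h : lact S.r (ract S.r a x) = lact S.r (ract S.r b x) := Quotient.exact h
      have hx := S.inv_right a x
      have hy := S.inv_right b x
      rw [S.ract_congr h] at hx
      have e := (S.right_bijective _).1 (hx.trans hy.symm)
      have h1 := S.leftPerm_mul a x
      rw [(S.lact_eq_iff _ _).1 h, e, ← S.leftPerm_mul b x] at h1
      exact Quotient.sound ((S.lact_eq_iff _ _).2 (mul_right_cancel h1))
    · intro q
      induction q using Quotient.inductionOn with | h b => ?_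
      obtain ⟨a, ha⟩ := (S.right_bijective x).2 b
      exact ⟨⟦a⟧, congrArg _ ha⟩
  braid := by
    funext ⟨p, q, s⟩
    induction p using Quotient.inductionOn with | h x => ?_
    induction q using Quotient.inductionOn with | h y => ?_
    induction s using Quotient.inductionOn with | h z => ?_
    have h := congrFun S.braid (x, y, z)
    exact congrArg (fun t : X × X × X => ((⟦t.1⟧, ⟦t.2.1⟧, ⟦t.2.2⟧) :
      Quotient S.retSetoid × Quotient S.retSetoid × Quotient S.retSetoid)) h

/-- The iterated retraction `Ret^m(X, r)`, together with its underlying set. -/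
def iterRet {X : Type u} (S : Solution X) (m : ℕ) : Σ Y : Type u, Solution Y :=
  (fun p : (Σ Y : Type u, Solution Y) => ⟨Quotient p.2.retSetoid, p.2.ret⟩)^[m] ⟨X, S⟩

/-- `(X, r)` is a multipermutation solution: some `Ret^m(X, r)` is the solution on a one-element
set. -/
def IsMultipermutation {X : Type u} (S : Solution X) : Prop :=
  ∃ m : ℕ, Nonempty (Unique (S.iterRet m).1)

/-! ### The group `G(X, r)` and its braiding operator -/

/-- The defining relations `xy = (ˣy)(xʸ)`. -/
def rels {X : Type u} (S : Solution X) : Set (FreeGroup X) :=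
  {w | ∃ x y : X, w = FreeGroup.of x * FreeGroup.of y *
    (FreeGroup.of (lact S.r x y) * FreeGroup.of (ract S.r x y))⁻¹}

/-- The Yang-Baxter (structure) group `G(X, r)`. -/
def YBGroup {X : Type u} (S : Solution X) : Type u := PresentedGroup S.rels

instance {X : Type u} (S : Solution X) : Group S.YBGroup :=
  inferInstanceAs (Group (PresentedGroup S.rels))

/-- The canonical map `X → G(X, r)`. -/
def gen {X : Type u} (S : Solution X) (x : X) : S.YBGroup := PresentedGroup.of x

theorem gen_mul {X : Type u} (S : Solution X) (x y : X) :
    S.gen x * S.gen y = S.gen (lact S.r x y) * S.gen (ract S.r x y) := by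
  have h : (PresentedGroup.mk S.rels) (FreeGroup.of x * FreeGroup.of y *
    (FreeGroup.of (lact S.r x y) * FreeGroup.of (ract S.r x y))⁻¹) = 1 :=
    PresentedGroup.one_of_mem ⟨x, y, rfl⟩
  rw [map_mul, map_inv, mul_inv_eq_one, map_mul, map_mul] at h
  exact h

/-- Universal property of `G(X, r)`. -/
def lift {X : Type u} (S : Solution X) {H : Type u} [Group H] (f : X → H)
    (hf : ∀ x y, f x * f y = f (lact S.r x y) * f (ract S.r x y)) : S.YBGroup →* H :=
  PresentedGroup.toGroup (f := f) (rels := S.rels) (by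
    rintro w ⟨x, y, rfl⟩
    simp [hf x y])

theorem lift_gen {X : Type u} (S : Solution X) {H : Type u} [Group H] (f : X → H)
    (hf : ∀ x y, f x * f y = f (lact S.r x y) * f (ract S.r x y)) (x : X) :
    S.lift f hf (S.gen x) = f x :=
  PresentedGroup.toGroup.of _

theorem induction_gen {X : Type u} (S : Solution X) {P : S.YBGroup → Prop}
    (hg : ∀ x, P (S.gen x)) (h1 : P 1) (hm : ∀ a b, P a → P b → P (a * b))
    (hi : ∀ a, P a → P a⁻¹) (a : S.YBGroup) : P a := by
  have h : a ∈ Subgroup.closure (Set.range (PresentedGroup.of : X → PresentedGroup S.rels)) := by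
    rw [PresentedGroup.closure_range_of]; trivial
  induction h using Subgroup.closure_induction with
  | mem x hx => obtain ⟨y, rfl⟩ := hx; exact hg y
  | one => exact h1
  | mul x y _ _ hx hy => exact hm x y hx hy
  | inv x _ hx => exact hi x hx

/-- The canonical homomorphism `𝓛 : G(X, r) → Sym(X)` extending `x ↦ 𝓛_x`. -/
noncomputable def leftHom {X : Type u} (S : Solution X) : S.YBGroup →* Equiv.Perm X :=
  S.lift S.leftPerm S.leftPerm_mul

theorem leftHom_gen {X : Type u} (S : Solution X) (x : X) :
    S.leftHom (S.gen x) = S.leftPerm x := S.lift_gen _ _ x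

/-- The canonical left action of `G(X, r)` on `X`. -/
noncomputable instance {X : Type u} (S : Solution X) : MulAction S.YBGroup X :=
  MulAction.compHom X S.leftHom

/-- The step `(s, h) ↦ (𝓛_{s(x)}⁻¹ s 𝓛_x, h s(x))`: reading a letter `x` in the state
`s ∈ Sym(X)`, write the letter `s(x)` and pass to the next state. -/
noncomputable def step {X : Type u} (S : Solution X) (x : X) (p : Equiv.Perm X × S.YBGroup) :
    Equiv.Perm X × S.YBGroup :=
  ((S.leftPerm (p.1 x))⁻¹ * p.1 * S.leftPerm x, p.2 * S.gen (p.1 x))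

theorem step_bijective {X : Type u} (S : Solution X) (x : X) :
    Function.Bijective (S.step x) := by
  have key : ∀ p : Equiv.Perm X × S.YBGroup,
      S.diag (p.1 x) = (S.step x p).1 (S.diag x) := by
    intro p
    change _ = (S.leftPerm (p.1 x))⁻¹ (p.1 (S.leftPerm x (S.diag x)))
    rw [leftPerm_apply, lact_diag]; rfl
  constructor
  · intro p q h
    have e : p.1 x = q.1 x := S.diag_bijective.1 (by rw [key, key, h])
    have h1 := congrArg Prod.fst h
    have h2 := congrArg Prod.snd h
    simp only [step, e] at h1 h2
    exact Prod.ext (mul_left_cancel (mul_right_cancel h1)) (mul_right_cancel h2)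
  · rintro ⟨t, h⟩
    obtain ⟨y, hy⟩ := S.diag_bijective.2 (t (S.diag x))
    have e : (S.leftPerm y * t * (S.leftPerm x)⁻¹) x = y := by
      change S.leftPerm y (t (S.diag x)) = y
      rw [← hy, leftPerm_apply, lact_diag]
    refine ⟨(S.leftPerm y * t * (S.leftPerm x)⁻¹, h * (S.gen y)⁻¹), ?_⟩
    simp only [step, e]
    refine Prod.ext ?_ ?_
    · change (S.leftPerm y)⁻¹ * (S.leftPerm y * t * (S.leftPerm x)⁻¹) * S.leftPerm x = t
      group
    · simp

/-- `step` as a permutation. -/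
noncomputable def stepPerm {X : Type u} (S : Solution X) (x : X) :
    Equiv.Perm (Equiv.Perm X × S.YBGroup) :=
  Equiv.ofBijective (S.step x) (S.step_bijective x)

theorem swap_aux {X : Type u} (S : Solution X) (u v : X) :
    lact S.r u ((S.leftPerm u)⁻¹ v) = v ∧
      ract S.r u ((S.leftPerm u)⁻¹ v) = (S.leftPerm v)⁻¹ u := by
  have h : lact S.r u ((S.leftPerm u)⁻¹ v) = v := (S.leftPerm u).apply_symm_apply v
  refine ⟨h, ?_⟩
  have h2 := S.inv_left u ((S.leftPerm u)⁻¹ v)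
  rw [h] at h2
  exact ((S.leftPerm v).symm_apply_eq.2 h2.symm).symm

theorem step_step {X : Type u} (S : Solution X) (x y : X) (p : Equiv.Perm X × S.YBGroup) :
    S.step y (S.step x p) = S.step (ract S.r x y) (S.step (lact S.r x y) p) := by
  obtain ⟨s, h⟩ := p
  have e1 : ((S.leftPerm (s x))⁻¹ * s * S.leftPerm x) y =
      (S.leftPerm (s x))⁻¹ (s (lact S.r x y)) := rfl
  have e2 : ((S.leftPerm (s (lact S.r x y)))⁻¹ * s * S.leftPerm (lact S.r x y)) (ract S.r x y) =
      (S.leftPerm (s (lact S.r x y)))⁻¹ (s x) := by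
    change (S.leftPerm (s (lact S.r x y)))⁻¹ (s (lact S.r (lact S.r x y) (ract S.r x y))) = _
    rw [inv_left]
  have hA := S.leftPerm_mul (s x) ((S.leftPerm (s x))⁻¹ (s (lact S.r x y)))
  have hB := S.gen_mul (s x) ((S.leftPerm (s x))⁻¹ (s (lact S.r x y)))
  rw [(S.swap_aux _ _).1, (S.swap_aux _ _).2] at hA hB
  simp only [step, e1, e2]
  refine Prod.ext ?_ ?_
  · have hC := S.leftPerm_mul x y
    have hA' := congrArg (fun t => t⁻¹) hA
    simp only [mul_inv_rev] at hA'
    calc _ = ((S.leftPerm ((S.leftPerm (s x))⁻¹ (s (lact S.r x y))))⁻¹ * (S.leftPerm (s x))⁻¹)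
            * s * (S.leftPerm x * S.leftPerm y) := by simp only [mul_assoc]
      _ = _ := by rw [hA', hC]; simp only [mul_assoc]
  · simp only [mul_assoc, hB]

/-- The right action of `G(X, r)` on `Sym(X) × G(X, r)` extending `step`. -/
noncomputable def run {X : Type u} (S : Solution X) :
    S.YBGroup →* (Equiv.Perm (Equiv.Perm X × S.YBGroup))ᵐᵒᵖ :=
  S.lift (fun x => MulOpposite.op (S.stepPerm x)) (by
    intro x y
    apply MulOpposite.unop_injective
    ext1 p
    exact S.step_step x y p)

/-- The element `ˢb` of `G(X, r)` for `s ∈ Sym(X)`, determined by `ˢ(bc) = (ˢb)(ᵗc)` with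
`t = 𝓛(ˢb)⁻¹ s 𝓛(b)` and by `ˢx = s(x)` on generators. -/
noncomputable def act {X : Type u} (S : Solution X) (s : Equiv.Perm X) (b : S.YBGroup) :
    S.YBGroup := ((S.run b).unop (s, 1)).2

/-- The braiding operator `r_G (a, b) = (ᵃb, aᵇ)` of `G = G(X, r)`, where `ᵃb = ᵗb` for `t = 𝓛(a)`
and `aᵇ = (ᵃb)⁻¹ a b`. -/
noncomputable def rG {X : Type u} (S : Solution X) :
    S.YBGroup × S.YBGroup → S.YBGroup × S.YBGroup :=
  fun p => (S.act (S.leftHom p.1) p.2, (S.act (S.leftHom p.1) p.2)⁻¹ * p.1 * p.2)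

end Solution

/-- `(G, σ)` is a symmetric group: a braided group with involutive braiding operator. -/
structure IsSymmetricGroup {G : Type u} [Group G] (σ : G × G → G × G) : Prop where
  involutive : σ ∘ σ = id
  ml0 : ∀ a, lact σ a 1 = 1 ∧ lact σ 1 a = a
  mr0 : ∀ a, ract σ 1 a = 1 ∧ ract σ a 1 = a
  ml1 : ∀ a b u, lact σ (a * b) u = lact σ a (lact σ b u)
  mr1 : ∀ a u v, ract σ a (u * v) = ract σ (ract σ a u) v
  ml2 : ∀ a u v, lact σ a (u * v) = lact σ a u * lact σ (ract σ a u) v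
  mr2 : ∀ a b u, ract σ (a * b) u = ract σ a (lact σ b u) * ract σ b u
  m3 : ∀ u v, u * v = lact σ u v * ract σ u v

namespace Solution

theorem run_gen {X : Type u} (S : Solution X) (x : X) (p : Equiv.Perm X × S.YBGroup) :
    (S.run (S.gen x)).unop p = S.step x p := by
  rw [run, lift_gen]; rfl

theorem run_mul {X : Type u} (S : Solution X) (a b : S.YBGroup)
    (p : Equiv.Perm X × S.YBGroup) :
    (S.run (a * b)).unop p = (S.run b).unop ((S.run a).unop p) := by
  rw [map_mul]; rfl

theorem run_inv {X : Type u} (S : Solution X) (a : S.YBGroup)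
    (p : Equiv.Perm X × S.YBGroup) :
    (S.run a).unop ((S.run a⁻¹).unop p) = p := by
  rw [← run_mul, inv_mul_cancel, map_one]; rfl

theorem run_eq {X : Type u} (S : Solution X) (b : S.YBGroup) :
    ∀ (s : Equiv.Perm X) (h : S.YBGroup), (S.run b).unop (s, h) =
      ((S.leftHom (S.act s b))⁻¹ * s * S.leftHom b, h * S.act s b) := by
  induction b using S.induction_gen with
  | hg x =>
    intro s h
    simp only [act, run_gen, step, one_mul, leftHom_gen]
  | h1 =>
    intro s h
    simp [act]
  | hm a b ha hb =>
    intro s h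
    have e : S.act s (a * b) = S.act s a * S.act ((S.leftHom (S.act s a))⁻¹ * s * S.leftHom a) b := by
      rw [act, run_mul, ha, hb]; simp
    rw [run_mul, ha, hb, e]
    refine Prod.ext ?_ ?_ <;> simp [mul_assoc]
  | hi a ha =>
    intro s h
    obtain ⟨⟨t, k⟩, hk⟩ : ∃ p, p = (S.run a⁻¹).unop (s, 1) := ⟨_, rfl⟩
    have h1 := S.run_inv a (s, 1)
    rw [← hk, ha] at h1
    have h1a := congrArg Prod.fst h1
    have h1b : k * S.act t a = 1 := congrArg Prod.snd h1
    simp only at h1a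
    have ek : S.act s a⁻¹ = k := by rw [act, ← hk]
    have e2 : (S.run a).unop (t, h * k) = (s, h) := by
      rw [ha, h1a, mul_assoc, h1b, mul_one]
    have e3 : (S.run a⁻¹).unop (s, h) = (t, h * k) := by
      rw [← e2, ← run_mul, mul_inv_cancel, map_one]; rfl
    rw [e3, ek, eq_inv_of_mul_eq_one_left h1b, ← h1a]
    refine Prod.ext ?_ rfl
    simp [mul_assoc]

/-- The state reached from `s` after reading `b`. -/
noncomputable def next {X : Type u} (S : Solution X) (s : Equiv.Perm X) (b : S.YBGroup) :
    Equiv.Perm X := (S.leftHom (S.act s b))⁻¹ * s * S.leftHom b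

theorem act_gen {X : Type u} (S : Solution X) (s : Equiv.Perm X) (x : X) :
    S.act s (S.gen x) = S.gen (s x) := by
  simp [act, run_gen, step]

theorem act_mul {X : Type u} (S : Solution X) (s : Equiv.Perm X) (a b : S.YBGroup) :
    S.act s (a * b) = S.act s a * S.act (S.next s a) b := by
  rw [act, run_mul, run_eq, run_eq]; simp [next]

theorem act_one {X : Type u} (S : Solution X) (s : Equiv.Perm X) : S.act s 1 = 1 := by
  simp [act]

theorem next_mul {X : Type u} (S : Solution X) (s : Equiv.Perm X) (a b : S.YBGroup) :
    S.next s (a * b) = S.next (S.next s a) b := by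
  simp only [next, act_mul, map_mul]; group

theorem next_one {X : Type u} (S : Solution X) (s : Equiv.Perm X) : S.next s 1 = s := by
  simp [next, act_one]

theorem act_inv {X : Type u} (S : Solution X) (s : Equiv.Perm X) (a : S.YBGroup) :
    S.act (S.next s a) a⁻¹ = (S.act s a)⁻¹ := by
  have h := S.act_mul s a a⁻¹
  rw [mul_inv_cancel, act_one] at h
  exact (inv_eq_of_mul_eq_one_right h.symm).symm

theorem exists_next {X : Type u} (S : Solution X) (s : Equiv.Perm X) (a : S.YBGroup) :
    ∃ t, S.next t a = s :=
  ⟨S.next s a⁻¹, by rw [← next_mul, inv_mul_cancel, next_one]⟩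

theorem act_comp {X : Type u} (S : Solution X) (b : S.YBGroup) :
    ∀ s t : Equiv.Perm X, S.act (s * t) b = S.act s (S.act t b) := by
  have nx : ∀ b : S.YBGroup, (∀ s t : Equiv.Perm X, S.act (s * t) b = S.act s (S.act t b)) →
      ∀ s t : Equiv.Perm X, S.next (s * t) b = S.next s (S.act t b) * S.next t b := by
    intro b hb s t
    simp only [next, hb]; group
  induction b using S.induction_gen with
  | hg x => intro s t; simp [act_gen]
  | h1 => intro s t; simp [act_one]
  | hm a b ha hb =>
    intro s t
    rw [act_mul, act_mul, act_mul, ha, nx a ha, hb]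
  | hi a ha =>
    intro s t
    obtain ⟨t, rfl⟩ := S.exists_next t a
    obtain ⟨s, rfl⟩ := S.exists_next s (S.act t a)
    rw [← nx a ha, act_inv, act_inv, act_inv, ha]

theorem act_id {X : Type u} (S : Solution X) (b : S.YBGroup) : S.act 1 b = b := by
  have nx : ∀ b : S.YBGroup, S.act 1 b = b → S.next 1 b = 1 := by
    intro b hb
    simp [next, hb]
  induction b using S.induction_gen with
  | hg x => simp [act_gen]
  | h1 => simp [act_one]
  | hm a b ha hb => rw [act_mul, ha, nx a ha, hb]
  | hi a ha =>
    have h := S.act_inv 1 a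
    rwa [nx a ha, ha] at h

theorem lact_rG {X : Type u} (S : Solution X) (a b : S.YBGroup) :
    lact S.rG a b = S.act (S.leftHom a) b := rfl

theorem rG_m3 {X : Type u} (S : Solution X) (a b : S.YBGroup) :
    a * b = lact S.rG a b * ract S.rG a b := by
  simp [lact, ract, rG, mul_assoc]

theorem ract_rG {X : Type u} (S : Solution X) (a b : S.YBGroup) :
    ract S.rG a b = (lact S.rG a b)⁻¹ * a * b := rfl

theorem leftHom_ract {X : Type u} (S : Solution X) (a b : S.YBGroup) :
    S.leftHom (ract S.rG a b) = S.next (S.leftHom a) b := by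
  simp [ract, rG, next]

theorem rG_ml1 {X : Type u} (S : Solution X) (a b u : S.YBGroup) :
    lact S.rG (a * b) u = lact S.rG a (lact S.rG b u) := by
  simp only [lact_rG, map_mul, act_comp]

theorem rG_ml2 {X : Type u} (S : Solution X) (a u v : S.YBGroup) :
    lact S.rG a (u * v) = lact S.rG a u * lact S.rG (ract S.rG a u) v := by
  simp only [lact_rG, leftHom_ract, act_mul]

theorem rG_mr1 {X : Type u} (S : Solution X) (a u v : S.YBGroup) :
    ract S.rG a (u * v) = ract S.rG (ract S.rG a u) v := by
  rw [ract_rG S a (u * v), rG_ml2, ract_rG S _ v]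
  rw [ract_rG S a u]; group

theorem rG_mr2 {X : Type u} (S : Solution X) (a b u : S.YBGroup) :
    ract S.rG (a * b) u = ract S.rG a (lact S.rG b u) * ract S.rG b u := by
  rw [ract_rG S (a * b), rG_ml1, ract_rG S a, ract_rG S b]; group

theorem rG_one_left {X : Type u} (S : Solution X) (a : S.YBGroup) : lact S.rG 1 a = a := by
  rw [lact_rG, map_one, act_id]

theorem rG_left_one {X : Type u} (S : Solution X) (a : S.YBGroup) : lact S.rG a 1 = 1 := by
  rw [lact_rG, act_one]

theorem lact_rG_gen {X : Type u} (S : Solution X) (x y : X) :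
    lact S.rG (S.gen x) (S.gen y) = S.gen (lact S.r x y) := by
  rw [lact_rG, leftHom_gen, act_gen, leftPerm_apply]

/-- `r_G` extends `r`. -/
theorem rG_gen {X : Type u} (S : Solution X) (x y : X) :
    S.rG (S.gen x, S.gen y) = (S.gen (lact S.r x y), S.gen (ract S.r x y)) := by
  refine Prod.ext (S.lact_rG_gen x y) ?_
  change ract S.rG (S.gen x) (S.gen y) = _
  rw [ract_rG, lact_rG_gen, mul_assoc, gen_mul, inv_mul_cancel_left]

theorem inv_iff {X : Type u} (S : Solution X) (a b : S.YBGroup) :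
    S.rG (S.rG (a, b)) = (a, b) ↔ lact S.rG (lact S.rG a b) (ract S.rG a b) = a := by
  constructor
  · intro h; exact congrArg Prod.fst h
  · intro h
    refine Prod.ext h ?_
    change ract S.rG (lact S.rG a b) (ract S.rG a b) = b
    rw [ract_rG, h, mul_assoc, ← rG_m3, inv_mul_cancel_left]

theorem rG_inv_gen {X : Type u} (S : Solution X) (a : S.YBGroup) :
    ∀ x : X, lact S.rG (lact S.rG a (S.gen x)) (ract S.rG a (S.gen x)) = a := by
  have hgen : ∀ (a : S.YBGroup) (x : X), lact S.rG a (S.gen x) = S.gen (S.leftHom a x) :=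
    fun a x => S.act_gen _ _
  induction a using S.induction_gen with
  | hg y =>
    intro x
    have h := S.rG_gen y x
    have h1 : lact S.rG (S.gen y) (S.gen x) = _ := congrArg Prod.fst h
    have h2 : ract S.rG (S.gen y) (S.gen x) = _ := congrArg Prod.snd h
    rw [h1, h2]
    simp only
    rw [lact_rG_gen, inv_left]
  | h1 =>
    intro x
    rw [rG_one_left, ract_rG, rG_one_left, mul_one, inv_mul_cancel, rG_left_one]
  | hm a b ha hb =>
    intro x
    have hbx := hb x
    have hax := ha (S.leftHom b x)
    rw [← hgen] at hax
    rw [rG_mr2, rG_ml1, rG_ml2, hax]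
    have h3 := ((S.inv_iff a _).2 hax)
    have h4 : ract S.rG (lact S.rG a (lact S.rG b (S.gen x)))
        (ract S.rG a (lact S.rG b (S.gen x))) = lact S.rG b (S.gen x) := congrArg Prod.snd h3
    rw [h4, hbx]
  | hi a ha =>
    intro x
    obtain ⟨y, hy⟩ : ∃ y, lact S.rG a⁻¹ (S.gen x) = S.gen y := ⟨_, hgen _ _⟩
    have hx : lact S.rG a (S.gen y) = S.gen x := by
      rw [← hy, ← rG_ml1, mul_inv_cancel, rG_one_left]
    have hay := ha y
    have h4 : ract S.rG (lact S.rG a (S.gen y)) (ract S.rG a (S.gen y)) = S.gen y :=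
      congrArg Prod.snd ((S.inv_iff a _).2 hay)
    rw [hx] at hay h4
    have hd : ract S.rG a⁻¹ (S.gen x) = (ract S.rG a (S.gen y))⁻¹ := by
      rw [ract_rG, ract_rG, hy, hx]; group
    rw [hy, hd]
    have h5 := S.rG_ml2 (S.gen x) (ract S.rG a (S.gen y)) (ract S.rG a (S.gen y))⁻¹
    rw [mul_inv_cancel, rG_left_one, hay, h4] at h5
    exact (inv_eq_of_mul_eq_one_right h5.symm).symm

theorem rG_inv {X : Type u} (S : Solution X) (b : S.YBGroup) :
    ∀ a : S.YBGroup, lact S.rG (lact S.rG a b) (ract S.rG a b) = a := by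
  induction b using S.induction_gen with
  | hg x => intro a; exact S.rG_inv_gen a x
  | h1 =>
    intro a
    rw [rG_left_one, rG_one_left, ract_rG, rG_left_one]; group
  | hm b c hb hc =>
    intro a
    rw [rG_ml2, rG_mr1, rG_ml1, hc, hb]
  | hi b hb =>
    intro a
    obtain ⟨e, rfl⟩ : ∃ e, ract S.rG e b = a :=
      ⟨ract S.rG a b⁻¹, by
        rw [← rG_mr1, inv_mul_cancel, ract_rG, rG_left_one]; group⟩
    have h5 := S.rG_ml2 e b b⁻¹
    rw [mul_inv_cancel, rG_left_one] at h5
    have h6 : lact S.rG (ract S.rG e b) b⁻¹ = (lact S.rG e b)⁻¹ :=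
      (inv_eq_of_mul_eq_one_right h5.symm).symm
    have h7 : ract S.rG (ract S.rG e b) b⁻¹ = e := by
      rw [← rG_mr1, mul_inv_cancel, ract_rG, rG_left_one]; group
    have h8 := hb e
    rw [h6, h7]
    calc lact S.rG (lact S.rG e b)⁻¹ e
        = lact S.rG (lact S.rG e b)⁻¹ (lact S.rG (lact S.rG e b) (ract S.rG e b)) := by rw [h8]
      _ = _ := by rw [← rG_ml1, inv_mul_cancel, rG_one_left]

/-- `(G, r_G)` is a symmetric group. -/
theorem rG_isSymmetricGroup {X : Type u} (S : Solution X) : IsSymmetricGroup S.rG where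
  involutive := funext fun p => (S.inv_iff p.1 p.2).2 (S.rG_inv p.2 p.1)
  ml0 a := ⟨S.rG_left_one a, S.rG_one_left a⟩
  mr0 a := ⟨by rw [ract_rG, rG_one_left]; group, by rw [ract_rG, rG_left_one]; group⟩
  ml1 := S.rG_ml1
  mr1 := S.rG_mr1
  ml2 := S.rG_ml2
  mr2 := S.rG_mr2
  m3 := S.rG_m3

/-! ### The permutation group `𝓖(X, r)` and its braiding operator -/

/-- The permutation group `𝓖(X, r) = 𝓛(G(X, r))`, a subgroup of `Sym(X)`. -/
noncomputable def permGroup {X : Type u} (S : Solution X) : Subgroup (Equiv.Perm X) :=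
  S.leftHom.range

/-- The epimorphism `𝓛 : G(X, r) → 𝓖(X, r)`. -/
noncomputable def toPermGroup {X : Type u} (S : Solution X) : S.YBGroup →* S.permGroup :=
  S.leftHom.rangeRestrict

theorem toPermGroup_surjective {X : Type u} (S : Solution X) :
    Function.Surjective S.toPermGroup := S.leftHom.rangeRestrict_surjective

/-- The braiding operator of `𝓖(X, r)` induced by `r_G`, that is
`r_𝓖 (𝓛(a), 𝓛(b)) = (𝓛(ᵃb), 𝓛(aᵇ))`; the value does not depend on the chosen preimages
by `rPerm_apply`. -/
noncomputable def rPerm {X : Type u} (S : Solution X) :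
    S.permGroup × S.permGroup → S.permGroup × S.permGroup :=
  fun p => Prod.map S.toPermGroup S.toPermGroup
    (S.rG (Function.surjInv S.toPermGroup_surjective p.1,
      Function.surjInv S.toPermGroup_surjective p.2))

theorem toPermGroup_eq_iff {X : Type u} (S : Solution X) (a b : S.YBGroup) :
    S.toPermGroup a = S.toPermGroup b ↔ S.leftHom a = S.leftHom b := Subtype.ext_iff

theorem lact_ker {X : Type u} (S : Solution X) (a k : S.YBGroup) (hk : S.leftHom k = 1) :
    S.leftHom (lact S.rG a k) = 1 := by
  have hk2 : S.leftHom (a * k * a⁻¹) = 1 := by simp [hk]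
  have h1 : lact S.rG (a * k * a⁻¹) a = a := by rw [lact_rG, hk2, act_id]
  have h2 : ract S.rG (a * k * a⁻¹) a = k := by rw [ract_rG, h1]; group
  have h3 := S.rG_inv a (a * k * a⁻¹)
  rw [h1, h2] at h3
  rw [h3, hk2]

theorem leftHom_lact_congr {X : Type u} (S : Solution X) {a a' b b' : S.YBGroup}
    (ha : S.leftHom a = S.leftHom a') (hb : S.leftHom b = S.leftHom b') :
    S.leftHom (lact S.rG a b) = S.leftHom (lact S.rG a' b') := by
  have e : lact S.rG a b = lact S.rG a' b := by rw [lact_rG, lact_rG, ha]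
  have hk : S.leftHom (b⁻¹ * b') = 1 := by simp [hb]
  have h := S.rG_ml2 a' b (b⁻¹ * b')
  rw [mul_inv_cancel_left] at h
  rw [h, map_mul, S.lact_ker _ _ hk, mul_one, e]

/-- `𝓛` is a homomorphism of symmetric groups from `(G, r_G)` onto `(𝓖, r_𝓖)`. -/
theorem rPerm_apply {X : Type u} (S : Solution X) (a b : S.YBGroup) :
    S.rPerm (S.toPermGroup a, S.toPermGroup b) =
      (S.toPermGroup (lact S.rG a b), S.toPermGroup (ract S.rG a b)) := by
  have ha := (S.toPermGroup_eq_iff _ _).1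
    (Function.surjInv_eq S.toPermGroup_surjective (S.toPermGroup a))
  have hb := (S.toPermGroup_eq_iff _ _).1
    (Function.surjInv_eq S.toPermGroup_surjective (S.toPermGroup b))
  refine Prod.ext ((S.toPermGroup_eq_iff _ _).2 (S.leftHom_lact_congr ha hb)) ?_
  refine (S.toPermGroup_eq_iff (ract S.rG _ _) _).2 ?_
  rw [leftHom_ract, leftHom_ract, next, next]
  have := S.leftHom_lact_congr ha hb
  rw [lact_rG, lact_rG] at this
  rw [this, ha, hb]

theorem lact_rPerm {X : Type u} (S : Solution X) (a b : S.YBGroup) :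
    lact S.rPerm (S.toPermGroup a) (S.toPermGroup b) = S.toPermGroup (lact S.rG a b) :=
  congrArg Prod.fst (S.rPerm_apply a b)

theorem ract_rPerm {X : Type u} (S : Solution X) (a b : S.YBGroup) :
    ract S.rPerm (S.toPermGroup a) (S.toPermGroup b) = S.toPermGroup (ract S.rG a b) :=
  congrArg Prod.snd (S.rPerm_apply a b)

/-- `(𝓖, r_𝓖)` is a symmetric group. -/
theorem rPerm_isSymmetricGroup {X : Type u} (S : Solution X) : IsSymmetricGroup S.rPerm := by
  have h := S.rG_isSymmetricGroup
  have sj := S.toPermGroup_surjective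
  have l := S.lact_rPerm
  have r := S.ract_rPerm
  have e1 : (1 : S.permGroup) = S.toPermGroup 1 := (map_one _).symm
  refine ⟨?_, ?_, ?_, ?_, ?_, ?_, ?_, ?_⟩
  · funext ⟨p, q⟩
    obtain ⟨a, rfl⟩ := sj p
    obtain ⟨b, rfl⟩ := sj q
    have hi := congrFun h.involutive (a, b)
    change S.rPerm (S.rPerm _) = _
    rw [rPerm_apply, rPerm_apply]
    exact congrArg (Prod.map S.toPermGroup S.toPermGroup) hi
  · intro p
    obtain ⟨a, rfl⟩ := sj p
    rw [e1, l, l, (h.ml0 a).1, (h.ml0 a).2]; exact ⟨rfl, rfl⟩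
  · intro p
    obtain ⟨a, rfl⟩ := sj p
    rw [e1, r, r, (h.mr0 a).1, (h.mr0 a).2]; exact ⟨rfl, rfl⟩
  · intro p q s
    obtain ⟨a, rfl⟩ := sj p
    obtain ⟨b, rfl⟩ := sj q
    obtain ⟨c, rfl⟩ := sj s
    rw [← map_mul, l, l, l, h.ml1]
  · intro p q s
    obtain ⟨a, rfl⟩ := sj p
    obtain ⟨b, rfl⟩ := sj q
    obtain ⟨c, rfl⟩ := sj s
    rw [← map_mul, r, r, r, h.mr1]
  · intro p q s
    obtain ⟨a, rfl⟩ := sj p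
    obtain ⟨b, rfl⟩ := sj q
    obtain ⟨c, rfl⟩ := sj s
    rw [← map_mul, l, l, r, l, h.ml2, map_mul]
  · intro p q s
    obtain ⟨a, rfl⟩ := sj p
    obtain ⟨b, rfl⟩ := sj q
    obtain ⟨c, rfl⟩ := sj s
    rw [← map_mul, r, l, r, r, h.mr2, map_mul]
  · intro p q
    obtain ⟨a, rfl⟩ := sj p
    obtain ⟨b, rfl⟩ := sj q
    rw [← map_mul, l, r, ← map_mul, ← h.m3]

end Solution

/-! ### Orbits and strong twisted unions -/

/-- The solution induced by `r` on the subset `Y` is the flip `(x, y) ↦ (y, x)`: it is a trivial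
solution or a one-element solution. -/
def IsTrivialOn {X : Type u} (r : X × X → X × X) (Y : Set X) : Prop :=
  ∀ x ∈ Y, ∀ y ∈ Y, r (x, y) = (y, x)

/-- The subset `Y ∪ Z` of `(X, r)` is a strong twisted union `Y ♮ Z` of the disjoint `r`-invariant
subsets `Y` and `Z`. -/
structure IsStrongTwistedPair {X : Type u} (r : X × X → X × X) (Y Z : Set X) : Prop where
  disjoint : Disjoint Y Z
  invariant_left : Set.MapsTo r (Y ×ˢ Y) (Y ×ˢ Y)
  invariant_right : Set.MapsTo r (Z ×ˢ Z) (Z ×ˢ Z)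
  /-- `r` restricts to bijections `Y × Z → Z × Y` and `Z × Y → Y × Z`. -/
  regular_left : Set.BijOn r (Y ×ˢ Z) (Z ×ˢ Y)
  regular_right : Set.BijOn r (Z ×ˢ Y) (Y ×ˢ Z)
  /-- The maps `x ↦ ᵅx` extend to a left action on `Y` of the group associated with `Z`. -/
  left_bijOn : ∀ α ∈ Z, Set.BijOn (lact r α) Y Y
  left_action : ∀ α ∈ Z, ∀ β ∈ Z, ∀ x ∈ Y,
    lact r α (lact r β x) = lact r (lact r α β) (lact r (ract r α β) x)
  /-- The maps `α ↦ αˣ` extend to a right action on `Z` of the group associated with `Y`. -/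
  right_bijOn : ∀ x ∈ Y, Set.BijOn (fun α => ract r α x) Z Z
  right_action : ∀ x ∈ Y, ∀ y ∈ Y, ∀ α ∈ Z,
    ract r (ract r α x) y = ract r (ract r α (lact r x y)) (ract r x y)
  stu_left : ∀ x ∈ Y, ∀ y ∈ Y, ∀ α ∈ Z, lact r (ract r α y) x = lact r α x
  stu_right : ∀ x ∈ Y, ∀ α ∈ Z, ∀ β ∈ Z, ract r α (lact r β x) = ract r α x

/-- `(X, r)` is the strong twisted union of the family of nonempty subsets `F i`: it is their
disjoint union, every `F i` is `r`-invariant, and any two different members of the family form a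
strong twisted union. -/
structure IsStrongTwistedUnion {X : Type u} {ι : Type u} (r : X × X → X × X) (F : ι → Set X) :
    Prop where
  nonempty : ∀ i, (F i).Nonempty
  cover : ⋃ i, F i = Set.univ
  disjoint : Pairwise fun i j => Disjoint (F i) (F j)
  invariant : ∀ i, Set.MapsTo r (F i ×ˢ F i) (F i ×ˢ F i)
  pair : ∀ i j, i ≠ j → IsStrongTwistedPair r (F i) (F j)

/-- The index set of the `G`-orbits in `X`, where `G = G(X, r)`. -/
abbrev Solution.Orbits {X : Type u} (S : Solution X) : Type u :=
  MulAction.orbitRel.Quotient S.YBGroup X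

end YBE

namespace YBE

/-! ### Symmetric groups with condition lri -/

section SymmetricGroup

variable {G : Type u} [Group G] {σ : G × G → G × G}

/-! In a symmetric group with lri the right action is the inverse of the left one, so everything is
expressed through the left action. Involutivity then gives the cyclic condition `lact_lact_self`;
applied to a product `b * c` and expanded, it yields the identity `lact_mul_lact`, on which all
later arguments rest.

If the solution is irretractable, `permGen` embeds `X` equivariantly into `𝓖`. Taking `a = b` to be
the image of `x` in `lact_mul_lact`, square-freeness and cancellation show that every point of the
orbit of `x` fixes `x`. Hence each orbit is trivial, and the braid relation together with this fact
gives the twisted union identities.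

For finite `X`, let `orbitFixer x` be the set of `n ∈ 𝓖` such that `n` and all `ᵍn` fix the orbit of
`x` pointwise. By `lact_mul_lact` it is closed under conjugation, hence behaves like an ideal: if
`w` lies in it, so does `(ʷa) a⁻¹`. Starting from `w ≠ 1` in the fixers of all points of `K`, choose
`a` moved by `w`; then `(ʷa) a⁻¹` is nontrivial and lies in the fixers of all points of `K ∪ {a}`.
In an irretractable solution `K` would thus grow forever, so a finite solution with at least two
points is retractable. The retraction inherits the hypotheses and is smaller, and induction on
cardinality finishes the proof. -/

theorem IsSymmetricGroup.lact_inv_lact (h : IsSymmetricGroup σ) (a b : G) :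
    lact σ a⁻¹ (lact σ a b) = b := by
  rw [← h.ml1, inv_mul_cancel, (h.ml0 b).2]

theorem IsSymmetricGroup.lact_lact_inv (h : IsSymmetricGroup σ) (a b : G) :
    lact σ a (lact σ a⁻¹ b) = b := by
  rw [← h.ml1, mul_inv_cancel, (h.ml0 b).2]

/-- Under lri the right action is the inverse of the left action. -/
theorem IsSymmetricGroup.ract_eq (h : IsSymmetricGroup σ) (hl : LRI σ) (a b : G) :
    ract σ a b = lact σ b⁻¹ a := by
  conv_rhs => rw [← (hl b a).2]
  rw [h.lact_inv_lact]

theorem IsSymmetricGroup.mul_eq (h : IsSymmetricGroup σ) (hl : LRI σ) (a b : G) :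
    a * b = lact σ a b * lact σ b⁻¹ a := by
  rw [← h.ract_eq hl, ← h.m3]

theorem IsSymmetricGroup.lact_mul (h : IsSymmetricGroup σ) (hl : LRI σ) (a u v : G) :
    lact σ a (u * v) = lact σ a u * lact σ (lact σ u⁻¹ a) v := by
  rw [h.ml2, h.ract_eq hl]

/-- The cyclic condition. -/
theorem IsSymmetricGroup.lact_lact_self (h : IsSymmetricGroup σ) (hl : LRI σ) (a b : G) :
    lact σ (lact σ b a) b = lact σ a b := by
  -- Involutivity at the pair `(ᵇa, b)`: by lri the right component `(ᵇa)ᵇ` is `a`, so `a⁻¹` carries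
  -- `lact σ (lact σ b a) b` back to `b`.
  have h1 : ract σ (lact σ (lact σ b a) b) (ract σ (lact σ b a) b) = b :=
    congrArg Prod.snd (congrFun h.involutive (lact σ b a, b))
  rw [h.ract_eq hl (lact σ b a) b, h.lact_inv_lact, h.ract_eq hl] at h1
  conv_rhs => rw [← h1]
  rw [h.lact_lact_inv]

/-- Both sides are expansions of the cyclic condition for `a` and `b * c`; the second factor on the
left simplifies by the cyclic condition for `a` and `c`. -/
theorem IsSymmetricGroup.lact_mul_lact (h : IsSymmetricGroup σ) (hl : LRI σ) (a b c : G) :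
    lact σ (lact σ c a) b * lact σ a c = lact σ a b * lact σ (lact σ b⁻¹ a) c := by
  have h1 := h.lact_lact_self hl a (b * c)
  rw [h.ml1, h.lact_mul hl, h.lact_inv_lact, h.lact_lact_self hl, h.lact_lact_self hl,
    h.lact_mul hl a] at h1
  exact h1

end SymmetricGroup

namespace Solution

/-! ### The equivariant map from `X` to the permutation group. -/

variable {X : Type u} (S : Solution X)

theorem perm_apply_inv {X : Type u} (f : Equiv.Perm X) (x : X) : f (f⁻¹ x) = x :=
  f.apply_symm_apply x

/-- The image of `x` in the permutation group. -/
noncomputable def permGen (x : X) : S.permGroup := S.toPermGroup (S.gen x)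

theorem coe_permGen (x : X) : (S.permGen x : Equiv.Perm X) = S.leftPerm x := S.leftHom_gen x

theorem permGen_apply (x y : X) : (S.permGen x : Equiv.Perm X) y = lact S.r x y := by
  rw [coe_permGen, leftPerm_apply]

theorem lact_permGen (g : S.permGroup) (x : X) :
    lact S.rPerm g (S.permGen x) = S.permGen ((g : Equiv.Perm X) x) := by
  obtain ⟨a, rfl⟩ := S.toPermGroup_surjective g
  rw [permGen, lact_rPerm, lact_rG, act_gen]; rfl

theorem permGen_injective (hr : ¬ S.IsRetractable) : Function.Injective S.permGen := by
  intro x y h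
  by_contra hne
  refine hr ⟨x, y, hne, ?_⟩
  rw [lact_eq_iff, ← coe_permGen, ← coe_permGen, h]

/-! ### Consequences of lri for irretractable square-free solutions. -/

section Irretractable

variable {S}

/-- Put `a = b = permGen x` in `lact_mul_lact`. Square-freeness makes `a` and `a⁻¹` fix `a`, so both
sides end in the same factor; cancelling it leaves an equality of images of points, and `permGen` is
injective. -/
theorem permGen_apply_self_of_orbit (hsf : IsSquareFree S.r) (hlri : LRI S.rPerm)
    (hr : ¬ S.IsRetractable) (c : S.permGroup) (x : X) :
    lact S.r ((c : Equiv.Perm X) x) x = x := by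
  have h := S.rPerm_isSymmetricGroup
  have hx : lact S.rPerm (S.permGen x) (S.permGen x) = S.permGen x := by
    rw [lact_permGen, permGen_apply]
    exact congrArg S.permGen (congrArg Prod.fst (hsf x))
  have hx' : lact S.rPerm (S.permGen x)⁻¹ (S.permGen x) = S.permGen x := by
    simpa only [hx] using h.lact_inv_lact (S.permGen x) (S.permGen x)
  have hF := h.lact_mul_lact hlri (S.permGen x) (S.permGen x) c
  rw [hx', hx] at hF
  have h1 := mul_right_cancel hF
  rw [lact_permGen, lact_permGen, permGen_apply] at h1
  exact S.permGen_injective hr h1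

theorem smul_def (g : S.YBGroup) (x : X) : g • x = S.leftHom g x := rfl

theorem gen_smul (x y : X) : S.gen x • y = lact S.r x y := by
  rw [smul_def, leftHom_gen, leftPerm_apply]

theorem lact_eq_of_mem_orbit (hsf : IsSquareFree S.r) (hlri : LRI S.rPerm)
    (hr : ¬ S.IsRetractable) {x y : X} (h : y ∈ MulAction.orbit S.YBGroup x) :
    lact S.r y x = x := by
  obtain ⟨g, rfl⟩ := h
  exact permGen_apply_self_of_orbit hsf hlri hr (S.toPermGroup g) x

/-- Under lri on the permutation group, the right action of an irretractable solution is the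
inverse of its left action. -/
theorem ract_eq_of_lri (hlri : LRI S.rPerm) (hr : ¬ S.IsRetractable) (x y : X) :
    ract S.r x y = (S.leftPerm y)⁻¹ x := by
  have h := S.rPerm_isSymmetricGroup
  have h1 := h.ract_eq hlri (S.permGen x) (S.permGen y)
  have h2 : ract S.rPerm (S.permGen x) (S.permGen y) = S.permGen (ract S.r x y) := by
    rw [permGen, permGen, ract_rPerm]
    exact congrArg (fun p => S.toPermGroup p.2) (S.rG_gen x y)
  rw [h2, lact_permGen, InvMemClass.coe_inv, coe_permGen] at h1
  exact S.permGen_injective hr h1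

/-- In `ʸ(ᵅx) = ^(ʸα)(^(yᵅ)x)` both `y` on the left and `yᵅ` on the right act trivially, since each
lies in the orbit of the point it acts on. -/
theorem lact_lact_of_mem_orbit (hsf : IsSquareFree S.r) (hlri : LRI S.rPerm)
    (hr : ¬ S.IsRetractable) {x y : X} (h : y ∈ MulAction.orbit S.YBGroup x) (α : X) :
    lact S.r (lact S.r y α) x = lact S.r α x := by
  have h1 := S.lact_lact y α x
  have h2 : lact S.r (ract S.r y α) x = x := by
    apply lact_eq_of_mem_orbit hsf hlri hr
    rw [ract_eq_of_lri hlri hr, ← leftHom_gen, ← map_inv, ← smul_def]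
    exact MulAction.mem_orbit_of_mem_orbit _ h
  have h3 : lact S.r y (lact S.r α x) = lact S.r α x := by
    apply lact_eq_of_mem_orbit hsf hlri hr
    rw [← gen_smul, MulAction.orbit_smul]
    exact h
  rw [h2, h3] at h1
  exact h1.symm

theorem lact_ract_of_mem_orbit (hsf : IsSquareFree S.r) (hlri : LRI S.rPerm)
    (hr : ¬ S.IsRetractable) {x y : X} (h : y ∈ MulAction.orbit S.YBGroup x) (α : X) :
    lact S.r (ract S.r α y) x = lact S.r α x := by
  -- Replace `α` by `αʸ`, which `y` sends back to `α`.
  have h1 := lact_lact_of_mem_orbit hsf hlri hr h (ract S.r α y)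
  rw [ract_eq_of_lri hlri hr, ← leftPerm_apply S y, perm_apply_inv] at h1
  rw [ract_eq_of_lri hlri hr, h1]

theorem ract_lact_of_mem_orbit (hsf : IsSquareFree S.r) (hlri : LRI S.rPerm)
    (hr : ¬ S.IsRetractable) {α β : X} (h : β ∈ MulAction.orbit S.YBGroup α) (x : X) :
    ract S.r α (lact S.r β x) = ract S.r α x := by
  have hx := ract_eq_of_lri hlri hr
  rw [hx, hx, Equiv.Perm.inv_eq_iff_eq, leftPerm_apply]
  -- With both right actions rewritten as inverses, the claim is the previous left identity at the
  -- base point `(S.leftPerm x)⁻¹ α`, which is still in the orbit of `α`.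
  have h2 : β ∈ MulAction.orbit S.YBGroup ((S.leftPerm x)⁻¹ α) := by
    rw [← leftHom_gen, ← map_inv, ← smul_def, MulAction.orbit_smul]
    exact h
  rw [lact_lact_of_mem_orbit hsf hlri hr h2, ← leftPerm_apply, perm_apply_inv]

end Irretractable

/-! ### Orbits -/

variable {S}

theorem lact_mem_orbit (i : S.Orbits) {x : X} (hx : x ∈ i.orbit) (a : X) :
    lact S.r a x ∈ i.orbit := by
  rw [MulAction.orbitRel.Quotient.mem_orbit] at hx ⊢
  rw [← hx, ← gen_smul]
  exact Quotient.sound (MulAction.mem_orbit x (S.gen a))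

theorem leftPerm_inv_mem_orbit (i : S.Orbits) {x : X} (hx : x ∈ i.orbit) (a : X) :
    (S.leftPerm a)⁻¹ x ∈ i.orbit := by
  rw [MulAction.orbitRel.Quotient.mem_orbit] at hx ⊢
  rw [← hx, ← leftHom_gen, ← map_inv, ← smul_def]
  exact Quotient.sound (MulAction.mem_orbit x (S.gen a)⁻¹)

/-- This needs only involutivity, so orbits are stable under the right action in every solution. -/
theorem ract_eq_leftPerm_inv (x y : X) :
    ract S.r x y = (S.leftPerm (lact S.r x y))⁻¹ x := by
  rw [Equiv.Perm.eq_inv_iff_eq, leftPerm_apply, inv_left]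

theorem ract_mem_orbit (i : S.Orbits) {x : X} (hx : x ∈ i.orbit) (a : X) :
    ract S.r x a ∈ i.orbit := by
  rw [ract_eq_leftPerm_inv]
  exact leftPerm_inv_mem_orbit i hx _

theorem mapsTo_orbit (i j : S.Orbits) :
    Set.MapsTo S.r (i.orbit ×ˢ j.orbit) (j.orbit ×ˢ i.orbit) := fun p hp =>
  ⟨lact_mem_orbit j hp.2 p.1, ract_mem_orbit i hp.1 p.2⟩

theorem bijOn_orbit (i j : S.Orbits) :
    Set.BijOn S.r (i.orbit ×ˢ j.orbit) (j.orbit ×ˢ i.orbit) :=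
  Set.InvOn.bijOn ⟨fun p _ => congrFun S.involutive p, fun p _ => congrFun S.involutive p⟩
    (mapsTo_orbit i j) (mapsTo_orbit j i)

theorem mem_orbit_of_mem (i : S.Orbits) {x y : X} (hx : x ∈ i.orbit) (hy : y ∈ i.orbit) :
    y ∈ MulAction.orbit S.YBGroup x := by
  rw [MulAction.orbitRel.Quotient.mem_orbit] at hx hy
  exact MulAction.orbitRel_apply.1 (Quotient.exact (hy.trans hx.symm))

theorem disjoint_orbit {i j : S.Orbits} (hij : i ≠ j) : Disjoint i.orbit j.orbit := by
  rw [Set.disjoint_left]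
  intro x hi hj
  rw [MulAction.orbitRel.Quotient.mem_orbit] at hi hj
  exact hij (hi.symm.trans hj)

theorem ract_ract (x y z : X) :
    ract S.r (ract S.r x y) z = ract S.r (ract S.r x (lact S.r y z)) (ract S.r y z) :=
  congrArg (fun p => p.2.2) (congrFun S.braid (x, y, z))

theorem isTrivialOn_orbit (hsf : IsSquareFree S.r) (hlri : LRI S.rPerm)
    (hr : ¬ S.IsRetractable) (i : S.Orbits) : IsTrivialOn S.r i.orbit := by
  intro x hx y hy
  refine Prod.ext (lact_eq_of_mem_orbit hsf hlri hr (mem_orbit_of_mem i hy hx)) ?_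
  change ract S.r x y = x
  rw [ract_eq_of_lri hlri hr, Equiv.Perm.inv_eq_iff_eq, leftPerm_apply,
    lact_eq_of_mem_orbit hsf hlri hr (mem_orbit_of_mem i hx hy)]

theorem isStrongTwistedPair_orbit (hsf : IsSquareFree S.r) (hlri : LRI S.rPerm)
    (hr : ¬ S.IsRetractable) {i j : S.Orbits} (hij : i ≠ j) :
    IsStrongTwistedPair S.r i.orbit j.orbit where
  disjoint := disjoint_orbit hij
  invariant_left := mapsTo_orbit i i
  invariant_right := mapsTo_orbit j j
  regular_left := bijOn_orbit i j
  regular_right := bijOn_orbit j i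
  left_bijOn α _ := by
    refine ⟨fun x hx => lact_mem_orbit i hx α, (S.left_bijective α).1.injOn, fun x hx => ?_⟩
    exact ⟨_, leftPerm_inv_mem_orbit i hx α, (S.leftPerm α).apply_symm_apply x⟩
  left_action α _ β _ x _ := S.lact_lact α β x
  right_bijOn x _ := by
    refine ⟨fun α hα => ract_mem_orbit j hα x, (S.right_bijective x).1.injOn, fun α hα => ?_⟩
    -- Under lri the left action of `x` undoes its right action, so it supplies the preimage inside
    -- the orbit.
    refine ⟨lact S.r x α, lact_mem_orbit j hα x, ?_⟩
    change ract S.r (lact S.r x α) x = α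
    rw [ract_eq_of_lri hlri hr]
    exact (S.leftPerm x).symm_apply_apply α
  right_action x _ y _ α _ := ract_ract α x y
  stu_left x hx y hy α _ := lact_ract_of_mem_orbit hsf hlri hr (mem_orbit_of_mem i hx hy) α
  stu_right x _ α hα β hβ := ract_lact_of_mem_orbit hsf hlri hr (mem_orbit_of_mem j hα hβ) x

theorem isStrongTwistedUnion_orbit (hsf : IsSquareFree S.r) (hlri : LRI S.rPerm)
    (hr : ¬ S.IsRetractable) :
    IsStrongTwistedUnion S.r (fun i : S.Orbits => i.orbit) where
  nonempty i := MulAction.orbitRel.Quotient.nonempty_orbit i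
  cover := Set.eq_univ_of_forall fun x =>
    Set.mem_iUnion.2 ⟨Quotient.mk _ x, MulAction.orbitRel.Quotient.mem_orbit.2 rfl⟩
  disjoint _ _ hij := disjoint_orbit hij
  invariant i := mapsTo_orbit i i
  pair _ _ hij := isStrongTwistedPair_orbit hsf hlri hr hij

/-! ### Finite irretractable solutions -/

/-- The elements of the permutation group all of whose left conjugates `ᵍn` fix the orbit of `x`
pointwise. -/
def orbitFixer (S : Solution X) (x : X) : Set S.permGroup :=
  {n | ∀ g h : S.permGroup, ((lact S.rPerm g n : S.permGroup) : Equiv.Perm X) ((h : Equiv.Perm X) x) =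
    (h : Equiv.Perm X) x}

theorem apply_of_mem_orbitFixer {x : X} {n : S.permGroup} (hn : n ∈ S.orbitFixer x)
    (h : S.permGroup) : (n : Equiv.Perm X) ((h : Equiv.Perm X) x) = (h : Equiv.Perm X) x := by
  have := hn 1 h
  rwa [(S.rPerm_isSymmetricGroup.ml0 n).2] at this

theorem lact_mem_orbitFixer {x : X} {n : S.permGroup} (hn : n ∈ S.orbitFixer x)
    (g : S.permGroup) : lact S.rPerm g n ∈ S.orbitFixer x := by
  intro g' h
  rw [← S.rPerm_isSymmetricGroup.ml1]
  exact hn _ h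

/-- Expanding `ᵍ(mn)` makes `n` be acted on by a different element than `g`; this is why
`orbitFixer` quantifies over all `g`. -/
theorem mul_mem_orbitFixer (hlri : LRI S.rPerm) {x : X} {m n : S.permGroup}
    (hm : m ∈ S.orbitFixer x) (hn : n ∈ S.orbitFixer x) : m * n ∈ S.orbitFixer x := by
  intro g h
  rw [S.rPerm_isSymmetricGroup.lact_mul hlri, Subgroup.coe_mul, Equiv.Perm.mul_apply, hn, hm]

theorem inv_mem_orbitFixer (hlri : LRI S.rPerm) {x : X} {n : S.permGroup}
    (hn : n ∈ S.orbitFixer x) : n⁻¹ ∈ S.orbitFixer x := by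
  have hs := S.rPerm_isSymmetricGroup
  intro g h
  -- Acting by `ⁿg` rather than `g` makes the factor at `n⁻¹` exactly `ᵍ(n⁻¹)`, the inverse of a
  -- translate of `n`.
  have h1 := hs.lact_mul hlri (lact S.rPerm n g) n n⁻¹
  rw [hs.lact_inv_lact, mul_inv_cancel, (hs.ml0 _).1] at h1
  rw [← inv_eq_of_mul_eq_one_right h1.symm, InvMemClass.coe_inv, Equiv.Perm.inv_eq_iff_eq]
  exact (hn _ h).symm

/-- In the expansion of `ᵍ(k n k⁻¹)` the last factor depends on `n`, but `lact_mul_lact` shows that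
on the orbit it agrees with its value at `n = 1`, which is `(ᵍk)⁻¹`. The middle factor fixes the
orbit, so the outer two cancel there. -/
theorem conj_mem_orbitFixer (hlri : LRI S.rPerm) {x : X} {n : S.permGroup}
    (hn : n ∈ S.orbitFixer x) (k : S.permGroup) : k * n * k⁻¹ ∈ S.orbitFixer x := by
  have hs := S.rPerm_isSymmetricGroup
  intro g h
  have h1 := hs.lact_mul hlri g k k⁻¹
  rw [mul_inv_cancel, (hs.ml0 _).1] at h1
  have h1' := inv_eq_of_mul_eq_one_right h1.symm
  have h2 : ((lact S.rPerm (lact S.rPerm n⁻¹ (lact S.rPerm k⁻¹ g)) k⁻¹ : S.permGroup) :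
      Equiv.Perm X) ((h : Equiv.Perm X) x) =
      ((lact S.rPerm (lact S.rPerm k⁻¹ g) k⁻¹ : S.permGroup) : Equiv.Perm X)
        ((h : Equiv.Perm X) x) := by
    have hF := congrArg (fun p : S.permGroup => (p : Equiv.Perm X) ((h : Equiv.Perm X) x))
      (hs.lact_mul_lact hlri (lact S.rPerm k⁻¹ g) n k⁻¹)
    simp only [Subgroup.coe_mul, Equiv.Perm.mul_apply] at hF
    have e1 := hn (lact S.rPerm k⁻¹ (lact S.rPerm k⁻¹ g))
      (lact S.rPerm (lact S.rPerm k⁻¹ g) k⁻¹ * h)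
    have e2 := hn (lact S.rPerm k⁻¹ g)
      (lact S.rPerm (lact S.rPerm n⁻¹ (lact S.rPerm k⁻¹ g)) k⁻¹ * h)
    simp only [Subgroup.coe_mul, Equiv.Perm.mul_apply] at e1 e2
    rw [e1, e2] at hF
    exact hF.symm
  rw [mul_assoc, hs.lact_mul hlri, hs.lact_mul hlri, Subgroup.coe_mul, Subgroup.coe_mul,
    Equiv.Perm.mul_apply, Equiv.Perm.mul_apply, h2, ← h1']
  have e := hn (lact S.rPerm k⁻¹ g) ((lact S.rPerm g k)⁻¹ * h)
  simp only [Subgroup.coe_mul, Equiv.Perm.mul_apply] at e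
  rw [e, InvMemClass.coe_inv, perm_apply_inv]

theorem lact_mul_inv_mem_orbitFixer (hlri : LRI S.rPerm) {x : X} {w : S.permGroup}
    (hw : w ∈ S.orbitFixer x) (a : S.permGroup) :
    lact S.rPerm w a * a⁻¹ ∈ S.orbitFixer x := by
  have h1 := S.rPerm_isSymmetricGroup.mul_eq hlri w a
  -- Solve `w a = (ʷa)(^(a⁻¹)w)` for `ʷa`: what remains is `w` times a conjugate of the inverse of a
  -- translate of `w`.
  have h2 : lact S.rPerm w a * a⁻¹ = w * (a * (lact S.rPerm a⁻¹ w)⁻¹ * a⁻¹) := by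
    rw [eq_mul_inv_of_mul_eq h1.symm]; group
  rw [h2]
  exact mul_mem_orbitFixer hlri hw (conj_mem_orbitFixer hlri
    (inv_mem_orbitFixer hlri (lact_mem_orbitFixer hw _)) _)

theorem permGen_mem_orbitFixer (hsf : IsSquareFree S.r) (hlri : LRI S.rPerm)
    (hr : ¬ S.IsRetractable) (c : S.permGroup) (x : X) :
    S.permGen ((c : Equiv.Perm X) x) ∈ S.orbitFixer x := by
  intro g h
  rw [lact_permGen, permGen_apply]
  -- Rebase the orbit at `h x`: there `g c x` is the image of the base point under `g c h⁻¹`.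
  have := permGen_apply_self_of_orbit hsf hlri hr (g * c * h⁻¹) ((h : Equiv.Perm X) x)
  simpa using this

/-- The witness `w` changes as `K` grows. The new one is `ʷa · a⁻¹` for the image of a moved point
`a`: being built from images of two points of one orbit, it lies in the fixer of `a`, and the ideal
property keeps it in the earlier fixers. -/
theorem exists_card_orbitFixer [Nontrivial X] (hsf : IsSquareFree S.r) (hlri : LRI S.rPerm)
    (hr : ¬ S.IsRetractable) (m : ℕ) :
    ∃ K : Finset X, K.card = m ∧ ∃ w : S.permGroup, w ≠ 1 ∧ ∀ x ∈ K, w ∈ S.orbitFixer x := by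
  classical
  induction m with
  | zero =>
    obtain ⟨x, y, hxy⟩ := exists_pair_ne X
    refine ⟨∅, rfl, S.permGen x * (S.permGen y)⁻¹, fun h => hxy ?_, by simp⟩
    exact S.permGen_injective hr (mul_inv_eq_one.1 h)
  | succ m ih =>
    obtain ⟨K, hK, w, hw1, hw⟩ := ih
    obtain ⟨a, ha⟩ : ∃ a, (w : Equiv.Perm X) a ≠ a := by
      by_contra! hcon
      exact hw1 (Subtype.ext (Equiv.ext hcon))
    have haK : a ∉ K := fun hmem => ha (apply_of_mem_orbitFixer (hw a hmem) 1)
    refine ⟨insert a K, by rw [Finset.card_insert_of_notMem haK, hK],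
      S.permGen ((w : Equiv.Perm X) a) * (S.permGen a)⁻¹, fun h => ha ?_, fun x hx => ?_⟩
    · exact S.permGen_injective hr (mul_inv_eq_one.1 h)
    · rcases Finset.mem_insert.1 hx with rfl | hx
      · exact mul_mem_orbitFixer hlri (permGen_mem_orbitFixer hsf hlri hr w x)
          (inv_mem_orbitFixer hlri (permGen_mem_orbitFixer hsf hlri hr 1 x))
      · rw [← lact_permGen]
        exact lact_mul_inv_mem_orbitFixer hlri (hw x hx) _

theorem isRetractable_of_finite [Nontrivial X] [Finite X] (hsf : IsSquareFree S.r)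
    (hlri : LRI S.rPerm) : S.IsRetractable := by
  by_contra hr
  have := Fintype.ofFinite X
  obtain ⟨K, hK, -⟩ := exists_card_orbitFixer hsf hlri hr (Fintype.card X + 1)
  have := K.card_le_univ
  omega

/-! ### Passing to the retraction -/

variable (S)

/-- The epimorphism `G(X, r) → G(Ret(X, r))`. -/
def retHom : S.YBGroup →* S.ret.YBGroup :=
  S.lift (fun x => S.ret.gen ⟦x⟧) fun x y => S.ret.gen_mul ⟦x⟧ ⟦y⟧

theorem retHom_gen (x : X) : S.retHom (S.gen x) = S.ret.gen ⟦x⟧ := S.lift_gen _ _ x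

theorem retHom_surjective : Function.Surjective S.retHom := by
  intro a
  induction a using S.ret.induction_gen with
  | hg p =>
    induction p using Quotient.inductionOn with | h x => exact ⟨S.gen x, S.retHom_gen x⟩
  | h1 => exact ⟨1, map_one _⟩
  | hm a b ha hb =>
    obtain ⟨a, rfl⟩ := ha
    obtain ⟨b, rfl⟩ := hb
    exact ⟨a * b, map_mul _ _ _⟩
  | hi a ha =>
    obtain ⟨a, rfl⟩ := ha
    exact ⟨a⁻¹, map_inv _ _⟩

/-- Says that the quotient map on `X` is equivariant; hence the kernel of `𝓛` also acts trivially on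
the retraction. -/
theorem leftHom_retHom (a : S.YBGroup) :
    ∀ x : X, S.ret.leftHom (S.retHom a) ⟦x⟧ = ⟦S.leftHom a x⟧ := by
  induction a using S.induction_gen with
  | hg y => intro x; rw [retHom_gen, leftHom_gen, leftHom_gen]; rfl
  | h1 => intro x; simp
  | hm a b ha hb => intro x; simp only [map_mul, Equiv.Perm.mul_apply, ha, hb]
  | hi a ha =>
    intro x
    rw [map_inv, map_inv, map_inv, Equiv.Perm.inv_eq_iff_eq, ha, perm_apply_inv]

theorem leftHom_retHom_congr {a b : S.YBGroup} (h : S.leftHom a = S.leftHom b) :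
    S.ret.leftHom (S.retHom a) = S.ret.leftHom (S.retHom b) := by
  ext p
  induction p using Quotient.inductionOn with | h x => ?_
  rw [leftHom_retHom, leftHom_retHom, h]

theorem retHom_lact (b : S.YBGroup) : ∀ a : S.YBGroup,
    S.retHom (lact S.rG a b) = lact S.ret.rG (S.retHom a) (S.retHom b) := by
  induction b using S.induction_gen with
  | hg x =>
    intro a
    rw [lact_rG, act_gen, retHom_gen, retHom_gen, lact_rG, act_gen, leftHom_retHom]
  | h1 => intro a; rw [map_one, rG_left_one, rG_left_one, map_one]
  | hm b c hb hc =>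
    intro a
    have hr : S.retHom (ract S.rG a b) = ract S.ret.rG (S.retHom a) (S.retHom b) := by
      rw [ract_rG, ract_rG, map_mul, map_mul, map_inv, hb]
    rw [rG_ml2, map_mul, map_mul, rG_ml2, hb, hc, hr]
  | hi b hb =>
    intro a
    -- Writing `a = eᵇ` turns `ᵃ(b⁻¹)` into `(ᵉb)⁻¹`, by expanding `ᵉ(b b⁻¹) = 1`.
    obtain ⟨e, rfl⟩ : ∃ e, ract S.rG e b = a :=
      ⟨ract S.rG a b⁻¹, by
        rw [← rG_mr1, inv_mul_cancel, ract_rG, rG_left_one]; group⟩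
    have hr : S.retHom (ract S.rG e b) = ract S.ret.rG (S.retHom e) (S.retHom b) := by
      rw [ract_rG, ract_rG, map_mul, map_mul, map_inv, hb]
    have h1 := S.rG_ml2 e b b⁻¹
    rw [mul_inv_cancel, rG_left_one] at h1
    have h2 := S.ret.rG_ml2 (S.retHom e) (S.retHom b) (S.retHom b)⁻¹
    rw [mul_inv_cancel, rG_left_one] at h2
    rw [map_inv, hr, ← inv_eq_of_mul_eq_one_right h1.symm, ← inv_eq_of_mul_eq_one_right h2.symm,
      map_inv, hb]

theorem retHom_ract (a b : S.YBGroup) :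
    S.retHom (ract S.rG a b) = ract S.ret.rG (S.retHom a) (S.retHom b) := by
  rw [ract_rG, ract_rG, map_mul, map_mul, map_inv, retHom_lact]

/-- Phrased on representatives in `G`, lri can be transported along `retHom` without constructing a
map between the permutation groups. -/
theorem lri_rPerm_iff : LRI S.rPerm ↔ ∀ a b : S.YBGroup,
    S.leftHom (ract S.rG (lact S.rG a b) a) = S.leftHom b ∧
      S.leftHom (lact S.rG a (ract S.rG b a)) = S.leftHom b := by
  simp only [LRI, S.toPermGroup_surjective.forall, lact_rPerm, ract_rPerm, toPermGroup_eq_iff]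

theorem lri_ret (hlri : LRI S.rPerm) : LRI S.ret.rPerm := by
  rw [lri_rPerm_iff] at hlri ⊢
  simp only [S.retHom_surjective.forall, ← retHom_lact, ← retHom_ract]
  exact fun a b => ⟨S.leftHom_retHom_congr (hlri a b).1, S.leftHom_retHom_congr (hlri a b).2⟩

theorem isSquareFree_ret (hsf : IsSquareFree S.r) : IsSquareFree S.ret.r := by
  intro p
  induction p using Quotient.inductionOn with | h x => ?_
  exact congrArg (Prod.map (Quotient.mk S.retSetoid) (Quotient.mk S.retSetoid)) (hsf x)

theorem isMultipermutation_of_ret (h : S.ret.IsMultipermutation) : S.IsMultipermutation := by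
  obtain ⟨m, hm⟩ := h
  -- `f^[m + 1] p` unfolds to `f^[m] (f p)`, so the retraction taken first matches definitionally.
  exact ⟨m + 1, hm⟩

theorem card_ret_lt [Finite X] (h : S.IsRetractable) :
    Nat.card (Quotient S.retSetoid) < Nat.card X := by
  obtain ⟨x, y, hne, hxy⟩ := h
  refine lt_of_le_of_ne (Nat.card_le_card_of_surjective _ Quotient.mk_surjective) fun hc => hne ?_
  exact (Nat.bijective_iff_surjective_and_card _).2 ⟨Quotient.mk_surjective, hc.symm⟩ |>.1
    (Quotient.sound (s := S.retSetoid) hxy)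

/-- Induction on a bound for the cardinality, over all types at once because the underlying set
changes. Only nonemptiness is assumed, as a retraction may be a single point. -/
theorem isMultipermutation_of_card (n : ℕ) : ∀ {X : Type u} [Nonempty X] [Finite X]
    (S : Solution X), Nat.card X ≤ n → IsSquareFree S.r → LRI S.rPerm →
    S.IsMultipermutation := by
  induction n with
  | zero =>
    intro X _ _ S hc
    exact absurd hc (by simpa using Nat.card_pos.ne')
  | succ n ih =>
    intro X _ _ S hc hsf hlri
    rcases subsingleton_or_nontrivial X with hX | hX
    · exact ⟨0, ⟨(uniqueOfSubsingleton (Classical.arbitrary X) : Unique X)⟩⟩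
    · have := S.card_ret_lt (isRetractable_of_finite hsf hlri)
      have : Nonempty (Quotient S.retSetoid) := ‹Nonempty X›.map (Quotient.mk _)
      exact S.isMultipermutation_of_ret
        (ih S.ret (by omega) (S.isSquareFree_ret hsf) (S.lri_ret hlri))

end Solution
end YBE

theorem mainTheorem8 {X : Type u} [Nontrivial X] (S : YBE.Solution X)
    (hsf : YBE.IsSquareFree S.r) (hlri : YBE.LRI S.rPerm) :
    (S.IsRetractable ∨
      ((∀ i : S.Orbits, YBE.IsTrivialOn S.r i.orbit) ∧
        YBE.IsStrongTwistedUnion S.r (fun i : S.Orbits => i.orbit))) ∧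
    (Finite X → S.IsMultipermutation) := by
  refine ⟨?_, fun _ => S.isMultipermutation_of_card _ le_rfl hsf hlri⟩
  by_cases hr : S.IsRetractable
  · exact Or.inl hr
  · exact Or.inr ⟨fun i => YBE.Solution.isTrivialOn_orbit hsf hlri hr i,
      YBE.Solution.isStrongTwistedUnion_orbit hsf hlri hr⟩
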